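/- Let $C_W>0$, $C_b\ge 0$, let $n_0,d\ge 1$, let $x^{(1)},\dots,x^{(d)}\in\mathbb R^{n_0}$, and let $\sigma:\mathbb R\to\mathbb R$ be Lipschitz with Lipschitz norm $\|\sigma\|_{\mathrm{Lip}}$. Let $b\sim\mathcal N(0,C_b)$ and let $W_1,\dots,W_{n_0}$ be i.i.d. real random variables, independent of $b$, with $\mathbb E[W_r]=0$ and $\mathbb E[W_r^2]=1$ (not necessarily Gaussian). Put $z(x)=b+\sqrt{C_W/n_0}\,\sum_{r=1}^{n_0}W_r x_r$ and define the limiting (NNGP) covariance matrices $K^{(\ell)}\in\mathbb R^{d\times d}$, $\ell\ge 2$, by $$K^{(2)}_{j,k}=C_b+C_W\,\mathbb E[\sigma(z(x^{(j)}))\sigma(z(x^{(k)}))],\qquad K^{(\ell)}_{j,k}=C_b+C_W\,\mathbb E\big[\sigma(G^{(\ell-1)}_1(x^{(j)}))\,\sigma(G^{(\ell-1)}_1(x^{(k)}))\big]\quad(\ell\ge 3),$$ where $(G^{(m)}_1(x^{(1)}),\dots,G^{(m)}_1(x^{(d)}))\sim\mathcal N_d(0,K^{(m)})$ for $m\ge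 2$. For a symmetric matrix $M$ let $\lambda(M)=\min_{\|y\|=1}y^{\top}My$ be its smallest eigenvalue. For $\ell\ge 3$ put $\hat K^{(\ell)}=K^{(\ell)}-C_b\mathbf 1_{d\times d}$, where $\mathbf 1_{d\times d}$ is the all-ones matrix, and $$D_\ell=\frac{C_W^{d(\ell-2)}}{d!}\,\lambda(K^{(2)})^d\sum_{\substack{k_1,\dots,k_d\in\{1,\dots,d\}\\ \text{pairwise distinct}}}\ \prod_{i=1}^d\ \prod_{r=1}^{\ell-2}\Big(\mathbb E\big[\sigma'(G^{(\ell-r)}_1(x^{(k_i)}))\big]\Big)^2 .$$ (If $\lambda(K^{(2)})>0$, then $\sigma'$ exists almost surely at all the Gaussian variables involved; if $\lambda(K^{(2)})=0$, then $D_\ell=0$.) The sum over tuples is the expanded form of the product $\prod_{i=1}^d\big(\sum_{k_i\notin\{k_1,\dots,k_{i-1}\}}\cdots\big)$, in which the range of each sum depends on the previous indices. Put also $$S_\ell=C_W\sum_{j=1}^d\mathbb E\big[\sigma(G^{(\ell-1)}_1(x^{(j)}))^2\big],\qquad T_\ell=(1+C_W)^2\big(1+(2C_W\|\sigma\|_{\mathrm{Lip}}^2)^{\ell-1}\big)\Big(d\,\ell\,(C_b+2|\sigma(0)|^2)+\frac1{n_0}\sum_{j=1}^d\|x^{(j)}\|^2\Big).$$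 Then for every $\ell\ge 3$: (a) $\det\hat K^{(\ell)}\ \ge\ D_\ell$; (b) $S_\ell^{\,d-1}\,\lambda(K^{(\ell)})\ge D_\ell$ and $T_\ell^{\,d-1}\,\lambda(K^{(\ell)})\ge D_\ell$; (c) if $\lambda(K^{(2)})>0$ and $\mathbb E[\sigma'(G^{(m)}_1(x^{(k)}))]\ne 0$ for all $2\le m\le\ell-1$ and $1\le k\le d$, then $D_\ell>0$, $\lambda(K^{(\ell)})\ge\lambda(\hat K^{(\ell)})>0$, and $$\frac1{\lambda(K^{(\ell)})}\le\frac1{\lambda(\hat K^{(\ell)})}\le\frac{(\operatorname{tr}\hat K^{(\ell)})^{d-1}}{\det\hat K^{(\ell)}}\le\frac{S_\ell^{\,d-1}}{D_\ell}\le\frac{T_\ell^{\,d-1}}{D_\ell}.$$ -/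

import Mathlib

/-! Gaussian integration by parts gives `Cov(σ(Xⱼ), Xₖ) = E[σ'(Xⱼ)] Cov(Xⱼ, Xₖ)` for a Gaussian
vector `X`. Hence, with `D = diag(E[σ'(Xⱼ)])`, the covariance matrix of the residuals
`σ(Xⱼ) - E[σ'(Xⱼ)] Xⱼ` is `Cov(σ(X)) - D Cov(X) D`. It is positive semidefinite, so
`C_W D⁽ˡ⁾ K⁽ˡ⁾ D⁽ˡ⁾ ≤ K⁽ˡ⁺¹⁾ - C_b 𝟏 ≤ K⁽ˡ⁺¹⁾` in the Loewner order. Iterating from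
`λ(K⁽²⁾) 1 ≤ K⁽²⁾` bounds `K⁽ˡ⁾ - C_b 𝟏` from below by a diagonal matrix, and the determinant is
monotone on positive semidefinite matrices. Since an injection of a finite set into itself is a
permutation, `D_ℓ` is exactly the determinant of that diagonal matrix.

The bounds on the smallest eigenvalue follow from `det A ≤ (tr A)ᵈ⁻¹ λ(A)` for positive semidefinite
`A`, and the explicit bound on the trace from the linear recursion
`tr K⁽ˡ⁺¹⁾ ≤ d (C_b + 2 C_W σ(0)²) + 2 C_W ‖σ‖²_Lip tr K⁽ˡ⁾`.
-/

open MeasureTheory ProbabilityTheory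
open scoped NNReal

noncomputable section

/-- The first component of the first layer at the input `x`:
`z = b + (√C_W / √n₀) ∑ₖ Wₖ xₖ`. -/
def firstLayer {Ω : Type*} {n₀ : ℕ} (CW : ℝ) (b : Ω → ℝ) (W : Fin n₀ → Ω → ℝ)
    (x : EuclideanSpace ℝ (Fin n₀)) (ω : Ω) : ℝ :=
  b ω + Real.sqrt CW / Real.sqrt n₀ * ∑ k, W k ω * x k

/-- The matrix `K⁽²⁾`, with entries `C_b + C_W E[σ(z(xⱼ)) σ(z(xₖ))]`, where `z` is the first component
of the (not necessarily Gaussian) first layer. -/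
def secondCov {Ω : Type*} [MeasurableSpace Ω] (P : Measure Ω) {n₀ d : ℕ} (σ : ℝ → ℝ) (Cb CW : ℝ)
    (b : Ω → ℝ) (W : Fin n₀ → Ω → ℝ) (x : Fin d → EuclideanSpace ℝ (Fin n₀)) :
    Matrix (Fin d) (Fin d) ℝ :=
  Matrix.of fun j k =>
    Cb + CW * ∫ ω, σ (firstLayer CW b W (x j) ω) * σ (firstLayer CW b W (x k) ω) ∂P

/-- One step of the layer-wise recursion: the matrix with entries `C_b + C_W E[σ(Gⱼ) σ(Gₖ)]`,
where `G` is a centered Gaussian vector with covariance `M`. -/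
def covStep {d : ℕ} (σ : ℝ → ℝ) (Cb CW : ℝ) (M : Matrix (Fin d) (Fin d) ℝ) :
    Matrix (Fin d) (Fin d) ℝ :=
  Matrix.of fun j k => Cb + CW * ∫ g, σ (g j) * σ (g k) ∂(multivariateGaussian 0 M)

/-- The limiting covariance matrices `K⁽ℓ⁾`, `ℓ ≥ 2`, at the inputs `x`
(the values at `ℓ = 0, 1` are placeholders). -/
def limitCov {Ω : Type*} [MeasurableSpace Ω] (P : Measure Ω) {n₀ d : ℕ} (σ : ℝ → ℝ) (Cb CW : ℝ)
    (b : Ω → ℝ) (W : Fin n₀ → Ω → ℝ) (x : Fin d → EuclideanSpace ℝ (Fin n₀)) :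
    ℕ → Matrix (Fin d) (Fin d) ℝ
  | 0 => 0
  | 1 => 0
  | 2 => secondCov P σ Cb CW b W x
  | ℓ + 3 => covStep σ Cb CW (limitCov P σ Cb CW b W x (ℓ + 2))

/-- `K - C_b 𝟏`, where `𝟏` is the all-ones matrix. -/
def hatCov {d : ℕ} (Cb : ℝ) (K : Matrix (Fin d) (Fin d) ℝ) : Matrix (Fin d) (Fin d) ℝ :=
  K - Cb • Matrix.of fun _ _ => (1 : ℝ)

/-- `λ(M) = min_{‖y‖ = 1} yᵀ M y` (Euclidean norm), the smallest eigenvalue of a symmetric `M`. -/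
def minEigen {d : ℕ} (M : Matrix (Fin d) (Fin d) ℝ) : ℝ :=
  ⨅ y : Metric.sphere (0 : EuclideanSpace ℝ (Fin d)) 1,
    (y : EuclideanSpace ℝ (Fin d)).ofLp ⬝ᵥ M.mulVec (y : EuclideanSpace ℝ (Fin d)).ofLp

/-- The Lipschitz norm: the least Lipschitz constant of a Lipschitz function. -/
def lipNorm (σ : ℝ → ℝ) : ℝ≥0 := sInf {c : ℝ≥0 | LipschitzWith c σ}

/-- `E[σ'(Gₖ)]` for a centered Gaussian vector `G` with covariance `M`. -/
def meanDeriv {d : ℕ} (σ : ℝ → ℝ) (M : Matrix (Fin d) (Fin d) ℝ) (k : Fin d) : ℝ :=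
  ∫ g, deriv σ (g k) ∂(multivariateGaussian 0 M)

/-- `E[σ(Gₖ)²]` for a centered Gaussian vector `G` with covariance `M`. -/
def meanSq {d : ℕ} (σ : ℝ → ℝ) (M : Matrix (Fin d) (Fin d) ℝ) (k : Fin d) : ℝ :=
  ∫ g, σ (g k) ^ 2 ∂(multivariateGaussian 0 M)

/-- The lower bound on the determinant. The product over `i` of the sums over `kᵢ ∉ {k₁, …, kᵢ₋₁}`,
whose ranges depend on the earlier indices, is the sum over all tuples `(k₁, …, k_d)` of
pairwise distinct indices of the product of the terms. -/
def detBound {d : ℕ} (σ : ℝ → ℝ) (CW : ℝ) (K : ℕ → Matrix (Fin d) (Fin d) ℝ) (ℓ : ℕ) : ℝ :=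
  CW ^ (d * (ℓ - 2)) / (d.factorial : ℝ) * minEigen (K 2) ^ d *
    ∑ k : Fin d ↪ Fin d, ∏ i, ∏ r ∈ Finset.Icc 1 (ℓ - 2), meanDeriv σ (K (ℓ - r)) (k i) ^ 2

/-- The explicit upper bound on the trace of `K⁽ℓ⁾ - C_b 𝟏`. -/
def traceBound {n₀ d : ℕ} (σ : ℝ → ℝ) (Cb CW : ℝ) (x : Fin d → EuclideanSpace ℝ (Fin n₀))
    (ℓ : ℕ) : ℝ :=
  (1 + CW) ^ 2 * (1 + (2 * CW * (lipNorm σ : ℝ) ^ 2) ^ (ℓ - 1)) *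
    (d * ℓ * (Cb + 2 * |σ 0| ^ 2) + (∑ j, ‖x j‖ ^ 2) / n₀)

end

section LoewnerOrder

open scoped MatrixOrder

variable {n : Type*} [Fintype n] [DecidableEq n] {A B : Matrix n n ℝ}

lemma smul_one_le_iff_le_eigenvalues (hA : A.IsHermitian) {c : ℝ} :
    c • (1 : Matrix n n ℝ) ≤ A ↔ ∀ i, c ≤ hA.eigenvalues i := by
  rw [← Algebra.algebraMap_eq_smul_one, algebraMap_le_iff_le_spectrum (ha := hA.isSelfAdjoint),
    hA.spectrum_real_eq_range_eigenvalues, Set.forall_mem_range]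

lemma one_le_det_of_one_le (h : 1 ≤ B) : 1 ≤ B.det := by
  have hB : B.IsHermitian := by
    simpa using (Matrix.le_iff.1 h).isHermitian.add Matrix.isHermitian_one
  have heig : ∀ i, 1 ≤ hB.eigenvalues i :=
    (smul_one_le_iff_le_eigenvalues hB).1 (by rwa [one_smul])
  rw [hB.det_eq_prod_eigenvalues]
  simpa using Finset.prod_le_prod (s := Finset.univ) (fun _ _ => zero_le_one) fun i _ => heig i

lemma det_le_det_of_le (hA : 0 ≤ A) (hAB : A ≤ B) : A.det ≤ B.det := by
  have hdetA : 0 ≤ A.det := (Matrix.nonneg_iff_posSemidef.1 hA).det_nonneg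
  have hdetB : 0 ≤ B.det := (Matrix.nonneg_iff_posSemidef.1 (hA.trans hAB)).det_nonneg
  rcases hdetA.eq_or_lt with h0 | h0
  · rwa [← h0]
  -- Conjugating by `A ^ (-1/2)` reduces the claim to `A = 1`.
  set S := CFC.sqrt A
  have hS : S * S = A := CFC.sqrt_mul_sqrt_self A hA
  have hdetS : S.det * S.det = A.det := by rw [← Matrix.det_mul, hS]
  have hS0 : S.det ≠ 0 := fun h => h0.ne' (by rw [← hdetS, h, zero_mul])
  have hSinv : IsSelfAdjoint S⁻¹ :=
    (Matrix.nonneg_iff_posSemidef.1 (CFC.sqrt_nonneg A)).inv.isHermitian.isSelfAdjoint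
  have hone : S⁻¹ * A * S⁻¹ = 1 := by
    rw [← hS, ← mul_assoc, Matrix.nonsing_inv_mul _ hS0.isUnit, one_mul,
      Matrix.mul_nonsing_inv _ hS0.isUnit]
  have hdet : (S⁻¹ * B * S⁻¹).det = B.det / A.det := by
    rw [Matrix.det_mul, Matrix.det_mul, Matrix.det_nonsing_inv, Ring.inverse_eq_inv', ← hdetS]
    field_simp
  rw [← one_le_div h0, ← hdet]
  exact one_le_det_of_one_le (hone ▸ hSinv.conjugate_le_conjugate hAB)

end LoewnerOrder

section MinEigen

open scoped MatrixOrder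

variable {d : ℕ} {A B : Matrix (Fin d) (Fin d) ℝ}

lemma minEigen_le_dotProduct_mulVec (M : Matrix (Fin d) (Fin d) ℝ)
    (y : Metric.sphere (0 : EuclideanSpace ℝ (Fin d)) 1) :
    minEigen M ≤ y.1.ofLp ⬝ᵥ M.mulVec y.1.ofLp := by
  have hcont : Continuous fun y : Metric.sphere (0 : EuclideanSpace ℝ (Fin d)) 1 =>
      y.1.ofLp ⬝ᵥ M.mulVec y.1.ofLp := by fun_prop
  exact ciInf_le (isCompact_range hcont).bddBelow y

lemma minEigen_le_eigenvalues (hA : A.IsHermitian) (i : Fin d) :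
    minEigen A ≤ hA.eigenvalues i := by
  have h := minEigen_le_dotProduct_mulVec A
    ⟨hA.eigenvectorBasis i, by simp [hA.eigenvectorBasis.norm_eq_one]⟩
  simpa [hA.eigenvalues_eq] using h

lemma smul_one_le_iff_le_minEigen [NeZero d] (hA : A.IsHermitian) {c : ℝ} :
    c • (1 : Matrix (Fin d) (Fin d) ℝ) ≤ A ↔ c ≤ minEigen A := by
  refine ⟨fun h => ?_, fun h => (smul_one_le_iff_le_eigenvalues hA).2 fun i =>
    h.trans (minEigen_le_eigenvalues hA i)⟩
  have : Nonempty (Metric.sphere (0 : EuclideanSpace ℝ (Fin d)) 1) :=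
    (NormedSpace.sphere_nonempty.2 zero_le_one).to_subtype
  refine le_ciInf fun y => ?_
  have hy : y.1.ofLp ⬝ᵥ y.1.ofLp = 1 := by
    calc y.1.ofLp ⬝ᵥ y.1.ofLp = ‖y.1‖ ^ 2 := by
          rw [EuclideanSpace.real_norm_sq_eq]
          simp only [dotProduct, pow_two]
      _ = 1 := by rw [norm_eq_of_mem_sphere, one_pow]
  have hquad := (Matrix.le_iff.1 h).dotProduct_mulVec_nonneg y.1.ofLp
  simpa [Matrix.sub_mulVec, Matrix.smul_mulVec, hy] using hquad

lemma minEigen_smul_one_le [NeZero d] (hA : A.IsHermitian) :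
    minEigen A • (1 : Matrix (Fin d) (Fin d) ℝ) ≤ A :=
  (smul_one_le_iff_le_minEigen hA).2 le_rfl

lemma minEigen_nonneg [NeZero d] (hA : A.PosSemidef) : 0 ≤ minEigen A :=
  (smul_one_le_iff_le_minEigen hA.isHermitian).1 (by simpa using hA.nonneg)

lemma minEigen_mono [NeZero d] (hA : A.IsHermitian) (hAB : A ≤ B) :
    minEigen A ≤ minEigen B := by
  have hB : B.IsHermitian := by simpa using hA.add (Matrix.le_iff.1 hAB).isHermitian
  exact (smul_one_le_iff_le_minEigen hB).1 ((minEigen_smul_one_le hA).trans hAB)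

lemma exists_eigenvalues_eq_minEigen [NeZero d] (hA : A.IsHermitian) :
    ∃ i, hA.eigenvalues i = minEigen A := by
  obtain ⟨i, hi⟩ := Finite.exists_min hA.eigenvalues
  exact ⟨i, le_antisymm ((smul_one_le_iff_le_minEigen hA).1
    ((smul_one_le_iff_le_eigenvalues hA).2 hi)) (minEigen_le_eigenvalues hA i)⟩

lemma det_le_trace_pow_mul_minEigen [NeZero d] (hA : A.PosSemidef) :
    A.det ≤ A.trace ^ (d - 1) * minEigen A := by
  -- All eigenvalues but the smallest one are bounded by the trace.
  obtain ⟨i, hi⟩ := exists_eigenvalues_eq_minEigen hA.isHermitian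
  have hle : ∀ j, hA.isHermitian.eigenvalues j ≤ A.trace := fun j => by
    rw [hA.isHermitian.trace_eq_sum_eigenvalues]
    exact Finset.single_le_sum (fun k _ => hA.eigenvalues_nonneg k) (Finset.mem_univ j)
  calc A.det = (∏ j ∈ Finset.univ.erase i, hA.isHermitian.eigenvalues j) * minEigen A := by
        rw [← hi, Finset.prod_erase_mul _ _ (Finset.mem_univ i),
          hA.isHermitian.det_eq_prod_eigenvalues]
        rfl
    _ ≤ (∏ _j ∈ Finset.univ.erase i, A.trace) * minEigen A := by
        gcongr with j
        · exact minEigen_nonneg hA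
        · exact fun j _ => hA.eigenvalues_nonneg j
        · exact hle j
    _ = A.trace ^ (d - 1) * minEigen A := by simp

lemma det_le_pow_mul_minEigen_of_le [NeZero d] (hA : A.PosSemidef) (hAB : A ≤ B) {t : ℝ}
    (ht : A.trace ≤ t) : A.det ≤ t ^ (d - 1) * minEigen B := by
  calc A.det ≤ A.trace ^ (d - 1) * minEigen A := det_le_trace_pow_mul_minEigen hA
    _ ≤ t ^ (d - 1) * minEigen B :=
        mul_le_mul (pow_le_pow_left₀ hA.trace_nonneg ht _) (minEigen_mono hA.isHermitian hAB)
          (minEigen_nonneg hA) (pow_nonneg (hA.trace_nonneg.trans ht) _)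

lemma minEigen_pos_of_det_pos [NeZero d] (hA : A.PosSemidef) (hdet : 0 < A.det) :
    0 < minEigen A :=
  pos_of_mul_pos_right (hdet.trans_le (det_le_trace_pow_mul_minEigen hA))
    (pow_nonneg hA.trace_nonneg _)

lemma inv_minEigen_le_trace_pow_div_det [NeZero d] (hA : A.PosSemidef) (hdet : 0 < A.det) :
    (minEigen A)⁻¹ ≤ A.trace ^ (d - 1) / A.det := by
  rw [le_div_iff₀ hdet, inv_mul_le_iff₀ (minEigen_pos_of_det_pos hA hdet), mul_comm]
  exact det_le_trace_pow_mul_minEigen hA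

end MinEigen

section Lipschitz

lemma lipschitzWith_lipNorm {c : ℝ≥0} {σ : ℝ → ℝ} (hσ : LipschitzWith c σ) :
    LipschitzWith (lipNorm σ) σ := by
  refine lipschitzWith_iff_dist_le_mul.2 fun s t => ?_
  rcases eq_or_ne s t with rfl | hst
  · simp
  have hpos : 0 < nndist s t := pos_iff_ne_zero.2 (nndist_eq_zero.not.2 hst)
  have hle : nndist (σ s) (σ t) / nndist s t ≤ lipNorm σ :=
    le_csInf ⟨c, hσ⟩ fun c' hc' => (div_le_iff₀ hpos).2 (LipschitzWith.nndist_le hc' s t)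
  exact_mod_cast (div_le_iff₀ hpos).1 hle

variable {Ω : Type*} [MeasurableSpace Ω] {P : Measure Ω} {c : ℝ≥0}

lemma memLp_comp_of_lipschitzWith {E F : Type*} [NormedAddCommGroup E] [NormedAddCommGroup F]
    [IsFiniteMeasure P] {f : E → F} (hf : LipschitzWith c f) {X : Ω → E} {p : ENNReal}
    (hX : MemLp X p P) : MemLp (fun ω => f (X ω)) p P := by
  have hcentered : MemLp (fun ω => f (X ω) - f 0) p P :=
    hX.of_le_mul
      ((hf.continuous.sub continuous_const).comp_aestronglyMeasurable hX.1)
      (ae_of_all _ fun ω => by simpa using hf.norm_sub_le (X ω) 0)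
  simpa [Pi.add_def] using hcentered.add (memLp_const (f 0))

lemma sq_le_of_lipschitzWith {σ : ℝ → ℝ} (hσ : LipschitzWith c σ) (t : ℝ) :
    σ t ^ 2 ≤ 2 * σ 0 ^ 2 + 2 * c ^ 2 * t ^ 2 := by
  have hdiff : (σ t - σ 0) ^ 2 ≤ (c * t) ^ 2 := by
    rw [sq_le_sq, abs_mul, NNReal.abs_eq]
    simpa [Real.dist_eq] using hσ.dist_le_mul t 0
  nlinarith [sq_nonneg (σ t - σ 0 - σ 0)]

lemma integral_sq_le_of_lipschitzWith [IsProbabilityMeasure P] {σ : ℝ → ℝ}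
    (hσ : LipschitzWith c σ) {X : Ω → ℝ} (hX : MemLp X 2 P) :
    ∫ ω, σ (X ω) ^ 2 ∂P ≤ 2 * σ 0 ^ 2 + 2 * c ^ 2 * ∫ ω, X ω ^ 2 ∂P := by
  have hX2 := hX.integrable_sq.const_mul (2 * (c : ℝ) ^ 2)
  calc ∫ ω, σ (X ω) ^ 2 ∂P ≤ ∫ ω, (2 * σ 0 ^ 2 + 2 * c ^ 2 * X ω ^ 2) ∂P :=
        integral_mono (memLp_comp_of_lipschitzWith hσ hX).integrable_sq
          ((integrable_const _).add hX2) fun ω => sq_le_of_lipschitzWith hσ (X ω)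
    _ = 2 * σ 0 ^ 2 + 2 * c ^ 2 * ∫ ω, X ω ^ 2 ∂P := by
        rw [integral_add (integrable_const _) hX2, integral_const, probReal_univ,
          one_smul, integral_const_mul]

end Lipschitz

section SecondMoment

open scoped MatrixOrder

variable {Ω ι : Type*} [MeasurableSpace Ω] {P : Measure Ω} {X : ι → Ω → ℝ}

/-- The matrix of second moments `E[Xᵢ Xⱼ]` of a family of real random variables. -/
noncomputable def secondMoment (P : Measure Ω) (X : ι → Ω → ℝ) : Matrix ι ι ℝ :=
  Matrix.of fun i j => ∫ ω, X i ω * X j ω ∂P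

/-- The covariance matrix of a family of real random variables. -/
noncomputable def covarianceMatrix (P : Measure Ω) (X : ι → Ω → ℝ) : Matrix ι ι ℝ :=
  Matrix.of fun i j => cov[X i, X j; P]

lemma trace_secondMoment [Fintype ι] :
    (secondMoment P X).trace = ∑ i, ∫ ω, X i ω ^ 2 ∂P := by
  simp [secondMoment, Matrix.trace, pow_two]

lemma integral_sum_mul_sq [Fintype ι] (hX : ∀ i, MemLp (X i) 2 P) (a : ι → ℝ) :
    ∫ ω, (∑ i, a i * X i ω) ^ 2 ∂P = a ⬝ᵥ (secondMoment P X).mulVec a := by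
  have hint : ∀ i j, Integrable (fun ω => a i * X i ω * (a j * X j ω)) P := fun i j =>
    ((hX i).const_mul (a i)).integrable_mul ((hX j).const_mul (a j))
  have hterm : ∀ i j, ∫ ω, a i * X i ω * (a j * X j ω) ∂P =
      a i * ((∫ ω, X i ω * X j ω ∂P) * a j) := fun i j => by
    rw [← integral_mul_const, ← integral_const_mul]
    exact integral_congr_ae (ae_of_all _ fun ω => by ring)
  simp only [pow_two, Finset.sum_mul_sum]
  rw [integral_finsetSum _ fun i _ => integrable_finsetSum _ fun j _ => hint i j]
  refine Finset.sum_congr rfl fun i _ => ?_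
  rw [integral_finsetSum _ fun j _ => hint i j]
  simp only [hterm, Matrix.mulVec, dotProduct, secondMoment, Matrix.of_apply, Finset.mul_sum]

lemma posSemidef_secondMoment [Finite ι] (hX : ∀ i, MemLp (X i) 2 P) :
    (secondMoment P X).PosSemidef := by
  cases nonempty_fintype ι
  refine .of_dotProduct_mulVec_nonneg ?_ fun a => ?_
  · ext i j
    simp [secondMoment, mul_comm]
  · rw [star_trivial, ← integral_sum_mul_sq hX]
    exact integral_nonneg fun ω => sq_nonneg _

lemma posSemidef_covarianceMatrix [Finite ι] [IsFiniteMeasure P] (hX : ∀ i, MemLp (X i) 2 P) :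
    (covarianceMatrix P X).PosSemidef :=
  posSemidef_secondMoment fun i => (hX i).sub (memLp_const (∫ ω, X i ω ∂P))

lemma covarianceMatrix_le_secondMoment [Finite ι] [IsProbabilityMeasure P]
    (hX : ∀ i, MemLp (X i) 2 P) : covarianceMatrix P X ≤ secondMoment P X := by
  have hdiff : secondMoment P X - covarianceMatrix P X =
      Matrix.vecMulVec (fun i => ∫ ω, X i ω ∂P) (star fun i => ∫ ω, X i ω ∂P) := by
    ext i j
    simp [secondMoment, covarianceMatrix, covariance_eq_sub (hX i) (hX j), Matrix.vecMulVec_apply]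
  rw [Matrix.le_iff, hdiff]
  exact Matrix.posSemidef_vecMulVec_self_star _

end SecondMoment

section Stein

lemma integral_deriv_mul_add_mul_deriv_eq_zero {f g : ℝ → ℝ}
    (hf : ∀ a b, AbsolutelyContinuousOnInterval f a b)
    (hg : ∀ a b, AbsolutelyContinuousOnInterval g a b)
    (hfg : Integrable fun t => f t * g t)
    (hderiv : Integrable fun t => deriv f t * g t + f t * deriv g t) :
    ∫ t, (deriv f t * g t + f t * deriv g t) = 0 := by
  have hlim := intervalIntegral_tendsto_integral hderiv Filter.tendsto_neg_atTop_atBot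
    Filter.tendsto_id
  simp only [(hf _ _).integral_deriv_mul_eq_sub (hg _ _), id_eq] at hlim
  refine ((hfg.sub hfg.comp_neg).integrableAtFilter Filter.atTop).eq_zero_of_tendsto ?_ hlim
  intro s hs
  obtain ⟨a, ha⟩ := Filter.mem_atTop_sets.1 hs
  exact top_unique ((Real.volume_Ici (a := a)).ge.trans (measure_mono ha))

lemma hasDerivAt_gaussianPDFReal (μ : ℝ) (v : ℝ≥0) (t : ℝ) :
    HasDerivAt (gaussianPDFReal μ v) (-((t - μ) / v) * gaussianPDFReal μ v t) t := by
  have hexponent : HasDerivAt (fun s : ℝ => -(s - μ) ^ 2 / (2 * v)) (-((t - μ) / v)) t :=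
    ((((hasDerivAt_id' t).sub_const μ).fun_pow 2).fun_neg.div_const (2 * (v : ℝ))).congr_deriv
      (by ring)
  rw [gaussianPDFReal_def]
  exact (hexponent.exp.const_mul _).congr_deriv (by ring)

lemma contDiff_gaussianPDFReal (μ : ℝ) (v : ℝ≥0) {n : ℕ∞} :
    ContDiff ℝ n (gaussianPDFReal μ v) := by
  rw [gaussianPDFReal_def]
  fun_prop

lemma integrable_gaussianReal_iff {μ : ℝ} {v : ℝ≥0} (hv : v ≠ 0) {f : ℝ → ℝ} :
    Integrable f (gaussianReal μ v) ↔ Integrable fun t => f t * gaussianPDFReal μ v t := by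
  rw [gaussianReal_of_var_ne_zero _ hv,
    integrable_withDensity_iff (measurable_gaussianPDF _ _) (by simp [gaussianPDF])]
  simp

variable {c : ℝ≥0} {σ : ℝ → ℝ}

lemma integrable_deriv_of_lipschitzWith {μ : Measure ℝ} [IsFiniteMeasure μ]
    (hσ : LipschitzWith c σ) : Integrable (deriv σ) μ :=
  .of_bound (measurable_deriv σ).aestronglyMeasurable c
    (ae_of_all _ fun _ => norm_deriv_le_of_lipschitz hσ)

lemma integral_mul_sub_gaussianReal (hσ : LipschitzWith c σ) (μ : ℝ) (v : ℝ≥0) :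
    ∫ t, σ t * (t - μ) ∂gaussianReal μ v = v * ∫ t, deriv σ t ∂gaussianReal μ v := by
  rcases eq_or_ne v 0 with rfl | hv
  · simp
  have hid : MemLp (fun t : ℝ => t) 2 (gaussianReal μ v) := memLp_id_gaussianReal 2
  have hσ2 : MemLp σ 2 (gaussianReal μ v) := memLp_comp_of_lipschitzWith hσ hid
  have hσφ : Integrable fun t => σ t * gaussianPDFReal μ v t :=
    (integrable_gaussianReal_iff hv).1 (hσ2.integrable one_le_two)
  have hσ'φ : Integrable fun t => deriv σ t * gaussianPDFReal μ v t :=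
    (integrable_gaussianReal_iff hv).1 (integrable_deriv_of_lipschitzWith hσ)
  have hσtφ : Integrable fun t => σ t * (t - μ) * gaussianPDFReal μ v t :=
    (integrable_gaussianReal_iff hv).1 (hσ2.integrable_mul (hid.sub (memLp_const μ)))
  have hσφ'_eq : ∀ t, σ t * deriv (gaussianPDFReal μ v) t =
      -(v : ℝ)⁻¹ * (σ t * (t - μ) * gaussianPDFReal μ v t) := fun t => by
    rw [(hasDerivAt_gaussianPDFReal μ v t).deriv]
    ring
  have hσφ' : Integrable fun t => σ t * deriv (gaussianPDFReal μ v) t := by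
    simpa only [hσφ'_eq] using hσtφ.const_mul _
  have hparts := integral_deriv_mul_add_mul_deriv_eq_zero
    (fun _ _ => hσ.lipschitzOnWith.absolutelyContinuousOnInterval)
    (fun _ _ => (contDiff_gaussianPDFReal μ v).contDiffOn.absolutelyContinuousOnInterval)
    hσφ (hσ'φ.add hσφ')
  rw [integral_add hσ'φ hσφ'] at hparts
  simp only [hσφ'_eq, integral_const_mul] at hparts
  simp only [integral_gaussianReal_eq_integral_smul hv, smul_eq_mul,
    mul_comm (gaussianPDFReal _ _ _)]
  rw [eq_neg_of_add_eq_zero_left hparts, neg_mul, neg_neg,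
    mul_inv_cancel_left₀ (NNReal.coe_ne_zero.2 hv)]

variable {Ω : Type*} [MeasurableSpace Ω] {P : Measure Ω} {X Y : Ω → ℝ}

lemma covariance_comp_self_of_hasGaussianLaw (hσ : LipschitzWith c σ) (hX : HasGaussianLaw X P) :
    cov[fun ω => σ (X ω), X; P] = (∫ ω, deriv σ (X ω) ∂P) * Var[X; P] := by
  set m := ∫ ω, σ (X ω) ∂P
  have hcentered : LipschitzWith c fun t => σ t - m := by
    simpa using hσ.sub (LipschitzWith.const m)
  have hmeas : AEStronglyMeasurable (fun t => (σ t - m) * (t - ∫ ω, X ω ∂P)) (P.map X) :=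
    (hcentered.continuous.mul (continuous_sub_right _)).aestronglyMeasurable
  calc cov[fun ω => σ (X ω), X; P] = ∫ t, (σ t - m) * (t - ∫ ω, X ω ∂P) ∂P.map X :=
        (integral_map hX.aemeasurable hmeas).symm
    _ = Var[X; P] * ∫ t, deriv σ t ∂P.map X := by
        rw [hX.map_eq_gaussianReal, integral_mul_sub_gaussianReal hcentered,
          Real.coe_toNNReal _ (variance_nonneg X P)]
        simp only [deriv_sub_const]
    _ = (∫ ω, deriv σ (X ω) ∂P) * Var[X; P] := by
        rw [integral_map hX.aemeasurable (measurable_deriv σ).aestronglyMeasurable, mul_comm]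

lemma covariance_eq_zero_of_variance_eq_zero [IsFiniteMeasure P] (hX : MemLp X 2 P)
    (h : Var[X; P] = 0) : cov[X, Y; P] = 0 := by
  refine integral_eq_zero_of_ae ?_
  filter_upwards [ae_eq_integral_of_variance_eq_zero hX h] with ω hω
  simp [hω]

lemma covariance_comp_of_hasGaussianLaw (hσ : LipschitzWith c σ)
    (hXY : HasGaussianLaw (fun ω => (X ω, Y ω)) P) :
    cov[fun ω => σ (X ω), Y; P] = (∫ ω, deriv σ (X ω) ∂P) * cov[X, Y; P] := by
  have := hXY.isProbabilityMeasure
  have hX := hXY.fst.memLp_two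
  have hY := hXY.snd.memLp_two
  have hσX := memLp_comp_of_lipschitzWith hσ hX
  obtain ⟨r, hr⟩ : ∃ r, cov[X, Y; P] = r * Var[X; P] := by
    by_cases h0 : Var[X; P] = 0
    · exact ⟨0, by rw [covariance_eq_zero_of_variance_eq_zero hX h0, zero_mul]⟩
    · exact ⟨cov[X, Y; P] / Var[X; P], by field_simp⟩
  -- `Y - r X` is uncorrelated with `X`, hence independent of it, which reduces to `Y = X`.
  have hrX : MemLp (fun ω => r * X ω) 2 P := hX.const_mul r
  have hres : HasGaussianLaw (fun ω => (X ω, Y ω - r * X ω)) P :=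
    hXY.map_fun ((ContinuousLinearMap.fst ℝ ℝ ℝ).prod
      (ContinuousLinearMap.snd ℝ ℝ ℝ - r • ContinuousLinearMap.fst ℝ ℝ ℝ))
  have hcov : cov[X, fun ω => Y ω - r * X ω; P] = 0 := by
    rw [covariance_fun_sub_right hX hY hrX, covariance_const_mul_right,
      covariance_self hX.aemeasurable, hr, sub_self]
  have hindep : cov[fun ω => σ (X ω), fun ω => Y ω - r * X ω; P] = 0 :=
    ((hres.indepFun_of_covariance_eq_zero hcov).comp hσ.continuous.measurable
      measurable_id).covariance_eq_zero hσX (hY.sub hrX)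
  rw [covariance_fun_sub_right hσX hY hrX, covariance_const_mul_right, sub_eq_zero] at hindep
  rw [hindep, covariance_comp_self_of_hasGaussianLaw hσ hXY.fst, hr]
  ring

variable {ι : Type*} [Fintype ι] [DecidableEq ι] {Z : ι → Ω → ℝ}

open scoped MatrixOrder

lemma diagonal_mul_covarianceMatrix_mul_diagonal_le (hσ : LipschitzWith c σ)
    (hZ : HasGaussianLaw (fun ω => (Z · ω)) P) :
    Matrix.diagonal (fun i => ∫ ω, deriv σ (Z i ω) ∂P) * covarianceMatrix P Z *
      Matrix.diagonal (fun i => ∫ ω, deriv σ (Z i ω) ∂P) ≤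
    covarianceMatrix P fun i ω => σ (Z i ω) := by
  have := hZ.isProbabilityMeasure
  set m := fun i => ∫ ω, deriv σ (Z i ω) ∂P
  have hZ2 : ∀ i, MemLp (Z i) 2 P := fun i => (hZ.eval i).memLp_two
  have hσZ : ∀ i, MemLp (fun ω => σ (Z i ω)) 2 P := fun i =>
    memLp_comp_of_lipschitzWith hσ (hZ2 i)
  have hmZ : ∀ i, MemLp (fun ω => m i * Z i ω) 2 P := fun i => (hZ2 i).const_mul (m i)
  have hstein : ∀ i j, cov[fun ω => σ (Z i ω), Z j; P] = m i * cov[Z i, Z j; P] := fun i j =>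
    covariance_comp_of_hasGaussianLaw hσ (hZ.prodMk i j)
  -- `m i * Z i` is the linear part of `σ (Z i)`, so the cross terms recombine.
  have hresidual : (covarianceMatrix P fun i ω => σ (Z i ω)) -
      Matrix.diagonal m * covarianceMatrix P Z * Matrix.diagonal m =
      covarianceMatrix P fun i ω => σ (Z i ω) - m i * Z i ω := by
    ext i j
    simp only [covarianceMatrix, Matrix.sub_apply, Matrix.mul_diagonal, Matrix.diagonal_mul,
      Matrix.of_apply]
    rw [covariance_fun_sub_fun_sub (hσZ i) (hmZ i) (hσZ j) (hmZ j)]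
    simp only [covariance_const_mul_left, covariance_const_mul_right, hstein,
      covariance_comm (Z i) (fun ω => σ (Z j ω)), covariance_comm (Z j) (Z i)]
    ring
  rw [Matrix.le_iff, hresidual]
  exact posSemidef_covarianceMatrix fun i => (hσZ i).sub (hmZ i)

end Stein

section CovStep

open scoped MatrixOrder

variable {d : ℕ} {c : ℝ≥0} {σ : ℝ → ℝ} {Cb CW : ℝ} {M : Matrix (Fin d) (Fin d) ℝ}

lemma hatCov_le (hCb : 0 ≤ Cb) (K : Matrix (Fin d) (Fin d) ℝ) : hatCov Cb K ≤ K := by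
  have hones : (Matrix.of fun _ _ : Fin d => (1 : ℝ)) = Matrix.vecMulVec 1 (star 1) := by
    ext i j
    simp [Matrix.vecMulVec_apply]
  rw [Matrix.le_iff, hatCov, sub_sub_cancel, hones]
  exact (Matrix.posSemidef_vecMulVec_self_star _).smul hCb

lemma trace_hatCov (K : Matrix (Fin d) (Fin d) ℝ) :
    (hatCov Cb K).trace = K.trace - d * Cb := by
  simp [hatCov, Matrix.trace]

lemma trace_hatCov_le (hCb : 0 ≤ Cb) (K : Matrix (Fin d) (Fin d) ℝ) :
    (hatCov Cb K).trace ≤ K.trace := by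
  rw [trace_hatCov]
  exact sub_le_self _ (by positivity)

lemma hatCov_covStep (σ : ℝ → ℝ) (Cb CW : ℝ) (M : Matrix (Fin d) (Fin d) ℝ) :
    hatCov Cb (covStep σ Cb CW M) =
      CW • secondMoment (multivariateGaussian 0 M) fun i g => σ (g i) := by
  ext i j
  simp [hatCov, covStep, secondMoment]

lemma trace_hatCov_covStep (σ : ℝ → ℝ) (Cb CW : ℝ) (M : Matrix (Fin d) (Fin d) ℝ) :
    (hatCov Cb (covStep σ Cb CW M)).trace = CW * ∑ j, meanSq σ M j := by
  rw [hatCov_covStep, Matrix.trace_smul, trace_secondMoment, smul_eq_mul]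
  rfl

lemma hasGaussianLaw_coord_multivariateGaussian (M : Matrix (Fin d) (Fin d) ℝ) :
    HasGaussianLaw (fun g : EuclideanSpace ℝ (Fin d) => (g ·)) (multivariateGaussian 0 M) :=
  IsGaussian.hasGaussianLaw_id.map_fun
    (EuclideanSpace.equiv (Fin d) ℝ : EuclideanSpace ℝ (Fin d) →L[ℝ] Fin d → ℝ)

lemma memLp_coord_multivariateGaussian (M : Matrix (Fin d) (Fin d) ℝ) (i : Fin d) :
    MemLp (fun g : EuclideanSpace ℝ (Fin d) => g i) 2 (multivariateGaussian 0 M) :=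
  ((hasGaussianLaw_coord_multivariateGaussian M).eval i).memLp_two

lemma covarianceMatrix_coord_multivariateGaussian (hM : M.PosSemidef) :
    covarianceMatrix (multivariateGaussian 0 M) (fun i g => g i) = M :=
  Matrix.ext fun i j => covariance_eval_multivariateGaussian hM i j

lemma integral_coord_sq_multivariateGaussian (hM : M.PosSemidef) (i : Fin d) :
    ∫ g, g i ^ 2 ∂multivariateGaussian 0 M = M i i := by
  have hmean : ∫ g, g i ∂multivariateGaussian 0 M = 0 := by
    have h := (EuclideanSpace.proj (𝕜 := ℝ) i).integral_comp_id_comm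
      (IsGaussian.integrable_id (μ := multivariateGaussian 0 M))
    simpa using h
  rw [← covariance_eval_multivariateGaussian hM i i,
    covariance_self (memLp_coord_multivariateGaussian M i).1.aemeasurable,
    variance_of_integral_eq_zero (memLp_coord_multivariateGaussian M i).1.aemeasurable hmean]

lemma sum_meanSq_le (hσ : LipschitzWith c σ) (hM : M.PosSemidef) :
    ∑ j, meanSq σ M j ≤ 2 * d * σ 0 ^ 2 + 2 * c ^ 2 * M.trace := by
  have hcoord : ∀ j, meanSq σ M j ≤ 2 * σ 0 ^ 2 + 2 * c ^ 2 * M j j := fun j => by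
    rw [← integral_coord_sq_multivariateGaussian hM j]
    exact integral_sq_le_of_lipschitzWith hσ (memLp_coord_multivariateGaussian M j)
  calc ∑ j, meanSq σ M j ≤ ∑ j, (2 * σ 0 ^ 2 + 2 * c ^ 2 * M j j) :=
        Finset.sum_le_sum fun j _ => hcoord j
    _ = 2 * d * σ 0 ^ 2 + 2 * c ^ 2 * M.trace := by
        simp only [Finset.sum_add_distrib, Finset.sum_const, Finset.card_univ, Fintype.card_fin,
          nsmul_eq_mul, Matrix.trace, Matrix.diag_apply, Finset.mul_sum]
        ring

lemma trace_covStep_le (hσ : LipschitzWith c σ) (hCW : 0 ≤ CW) (hM : M.PosSemidef) :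
    (covStep σ Cb CW M).trace ≤
      d * (Cb + 2 * CW * σ 0 ^ 2) + 2 * CW * c ^ 2 * M.trace := by
  have htrace := trace_hatCov_covStep σ Cb CW M
  rw [trace_hatCov] at htrace
  linarith [mul_le_mul_of_nonneg_left (sum_meanSq_le hσ hM) hCW]

lemma posSemidef_hatCov_covStep (hσ : LipschitzWith c σ) (hCW : 0 ≤ CW) :
    (hatCov Cb (covStep σ Cb CW M)).PosSemidef := by
  rw [hatCov_covStep]
  exact (posSemidef_secondMoment fun i =>
    memLp_comp_of_lipschitzWith hσ (memLp_coord_multivariateGaussian M i)).smul hCW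

lemma posSemidef_of_posSemidef_hatCov {K : Matrix (Fin d) (Fin d) ℝ} (hCb : 0 ≤ Cb)
    (hK : (hatCov Cb K).PosSemidef) : K.PosSemidef :=
  Matrix.nonneg_iff_posSemidef.1 (hK.nonneg.trans (hatCov_le hCb K))

lemma smul_diagonal_mul_mul_diagonal_le_hatCov_covStep (hσ : LipschitzWith c σ) (hCW : 0 ≤ CW)
    (hM : M.PosSemidef) :
    CW • (Matrix.diagonal (meanDeriv σ M) * M * Matrix.diagonal (meanDeriv σ M)) ≤
      hatCov Cb (covStep σ Cb CW M) := by
  have hstein := diagonal_mul_covarianceMatrix_mul_diagonal_le hσ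
    (hasGaussianLaw_coord_multivariateGaussian M)
  rw [covarianceMatrix_coord_multivariateGaussian hM] at hstein
  rw [hatCov_covStep]
  exact smul_le_smul_of_nonneg_left (hstein.trans (covarianceMatrix_le_secondMoment fun i =>
    memLp_comp_of_lipschitzWith hσ (memLp_coord_multivariateGaussian M i))) hCW

end CovStep

section LinearRecursion

variable {p q A : ℝ}

lemma geom_sum_le_card_mul_one_add_pow (hq : 0 ≤ q) (n : ℕ) :
    ∑ i ∈ Finset.range n, q ^ i ≤ n * (1 + q ^ n) := by
  have hterm : ∀ i ∈ Finset.range n, q ^ i ≤ 1 + q ^ n := fun i hi => by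
    rcases le_total q 1 with h1 | h1
    · linarith [pow_le_one₀ hq h1 (n := i), pow_nonneg hq n]
    · linarith [pow_le_pow_right₀ h1 (Finset.mem_range.1 hi).le]
  simpa only [Finset.card_range, nsmul_eq_mul] using Finset.sum_le_card_nsmul _ _ _ hterm

lemma le_geom_sum_mul_add_of_le_add_mul (hq : 0 ≤ q) {u : ℕ → ℝ}
    (h0 : u 0 ≤ p + q * A) (hu : ∀ n, u (n + 1) ≤ p + q * u n) (n : ℕ) :
    u n ≤ (∑ i ∈ Finset.range (n + 1), q ^ i) * p + q ^ (n + 1) * A := by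
  induction n with
  | zero => simpa using h0
  | succ n ih =>
    calc u (n + 1) ≤ p + q * u n := hu n
      _ ≤ p + q * ((∑ i ∈ Finset.range (n + 1), q ^ i) * p + q ^ (n + 1) * A) := by gcongr
      _ = (∑ i ∈ Finset.range (n + 2), q ^ i) * p + q ^ (n + 2) * A := by
        rw [geom_sum_succ (n := n + 1)]
        ring

lemma le_of_le_add_mul (hp : 0 ≤ p) (hq : 0 ≤ q) (hA : 0 ≤ A) {u : ℕ → ℝ}
    (h0 : u 0 ≤ p + q * A) (hu : ∀ n, u (n + 1) ≤ p + q * u n) (n : ℕ) :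
    u n ≤ (1 + q ^ (n + 1)) * ((n + 1) * p + A) := by
  have hgeom := mul_le_mul_of_nonneg_right (geom_sum_le_card_mul_one_add_pow hq (n + 1)) hp
  push_cast at hgeom
  linarith [le_geom_sum_mul_add_of_le_add_mul hq h0 hu n]

end LinearRecursion

section Recursion

open scoped MatrixOrder

variable {d : ℕ} {c : ℝ≥0} {σ : ℝ → ℝ} {Cb CW : ℝ} {K : ℕ → Matrix (Fin d) (Fin d) ℝ}

lemma posSemidef_of_covStep (hσ : LipschitzWith c σ) (hCb : 0 ≤ Cb) (hCW : 0 ≤ CW)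
    (h2 : (K 2).PosSemidef) (hK : ∀ n, K (n + 3) = covStep σ Cb CW (K (n + 2))) :
    ∀ n, (K (n + 2)).PosSemidef
  | 0 => h2
  | n + 1 => hK n ▸ posSemidef_of_posSemidef_hatCov hCb (posSemidef_hatCov_covStep hσ hCW)

lemma trace_le_of_covStep (hσ : LipschitzWith c σ) (hCb : 0 ≤ Cb) (hCW : 0 ≤ CW)
    (h2 : (K 2).PosSemidef) (hK : ∀ n, K (n + 3) = covStep σ Cb CW (K (n + 2))) {A : ℝ}
    (hA : 0 ≤ A)
    (h0 : (K 2).trace ≤ d * (Cb + 2 * CW * σ 0 ^ 2) + 2 * CW * c ^ 2 * A) (n : ℕ) :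
    (K (n + 2)).trace ≤ (1 + (2 * CW * c ^ 2) ^ (n + 1)) *
      ((n + 1) * (d * (Cb + 2 * CW * σ 0 ^ 2)) + A) :=
  le_of_le_add_mul (u := fun n => (K (n + 2)).trace) (by positivity) (by positivity) hA h0
    (fun n => hK n ▸ trace_covStep_le hσ hCW (posSemidef_of_covStep hσ hCb hCW h2 hK n)) n

/-- The diagonal entries `λ(K⁽²⁾) C_Wⁿ ∏_{m < n} E[σ'(G⁽ᵐ⁺²⁾ᵢ)]²` of the diagonal matrix that
bounds `K⁽ⁿ⁺²⁾` from below. -/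
noncomputable def diagBound (σ : ℝ → ℝ) (CW : ℝ) (K : ℕ → Matrix (Fin d) (Fin d) ℝ) (n : ℕ)
    (i : Fin d) : ℝ :=
  minEigen (K 2) * CW ^ n * ∏ m ∈ Finset.range n, meanDeriv σ (K (m + 2)) i ^ 2

lemma diagBound_nonneg [NeZero d] (hCW : 0 ≤ CW) (h2 : (K 2).PosSemidef) (n : ℕ) (i : Fin d) :
    0 ≤ diagBound σ CW K n i :=
  mul_nonneg (mul_nonneg (minEigen_nonneg h2) (pow_nonneg hCW n))
    (Finset.prod_nonneg fun _ _ => sq_nonneg _)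

lemma diagonal_diagBound_succ (n : ℕ) :
    Matrix.diagonal (diagBound σ CW K (n + 1)) =
      CW • (Matrix.diagonal (meanDeriv σ (K (n + 2))) * Matrix.diagonal (diagBound σ CW K n) *
        Matrix.diagonal (meanDeriv σ (K (n + 2)))) := by
  rw [Matrix.diagonal_mul_diagonal, Matrix.diagonal_mul_diagonal, ← Matrix.diagonal_smul]
  congr 1
  ext i
  simp only [diagBound, Finset.prod_range_succ, Pi.smul_apply, smul_eq_mul]
  ring

lemma diagonal_diagBound_succ_le_hatCov (hσ : LipschitzWith c σ) (hCb : 0 ≤ Cb) (hCW : 0 ≤ CW)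
    (h2 : (K 2).PosSemidef) (hK : ∀ n, K (n + 3) = covStep σ Cb CW (K (n + 2))) {n : ℕ}
    (hn : Matrix.diagonal (diagBound σ CW K n) ≤ K (n + 2)) :
    Matrix.diagonal (diagBound σ CW K (n + 1)) ≤ hatCov Cb (K (n + 3)) := by
  have hD : IsSelfAdjoint (Matrix.diagonal (meanDeriv σ (K (n + 2)))) :=
    Matrix.isHermitian_diagonal _
  rw [diagonal_diagBound_succ, hK]
  exact (smul_le_smul_of_nonneg_left (hD.conjugate_le_conjugate hn) hCW).trans
    (smul_diagonal_mul_mul_diagonal_le_hatCov_covStep hσ hCW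
      (posSemidef_of_covStep hσ hCb hCW h2 hK n))

lemma diagonal_diagBound_le [NeZero d] (hσ : LipschitzWith c σ) (hCb : 0 ≤ Cb) (hCW : 0 ≤ CW)
    (h2 : (K 2).PosSemidef) (hK : ∀ n, K (n + 3) = covStep σ Cb CW (K (n + 2))) (n : ℕ) :
    Matrix.diagonal (diagBound σ CW K n) ≤ K (n + 2) := by
  induction n with
  | zero =>
    have hbase : Matrix.diagonal (diagBound σ CW K 0) = minEigen (K 2) • 1 := by
      simp [Matrix.smul_one_eq_diagonal, diagBound]
    exact hbase ▸ minEigen_smul_one_le h2.isHermitian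
  | succ n ih =>
    exact (diagonal_diagBound_succ_le_hatCov hσ hCb hCW h2 hK ih).trans (hatCov_le hCb _)

lemma sum_embedding_prod {ι R : Type*} [Fintype ι] [CommSemiring R] (f : ι → R) :
    ∑ k : ι ↪ ι, ∏ i, f (k i) = (Fintype.card ι).factorial * ∏ i, f i := by
  classical
  have hperm : ∀ k : ι ↪ ι, ∏ i, f (k i) = ∏ i, f i := fun k =>
    (Finite.injective_iff_bijective.1 k.injective).prod_comp f
  simp [hperm, Fintype.card_embedding_eq, Nat.descFactorial_self]

lemma detBound_eq_prod_diagBound (σ : ℝ → ℝ) (CW : ℝ) (K : ℕ → Matrix (Fin d) (Fin d) ℝ)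
    (n : ℕ) : detBound σ CW K (n + 2) = ∏ i, diagBound σ CW K n i := by
  have hreindex : ∀ i, ∏ r ∈ Finset.Icc 1 n, meanDeriv σ (K (n + 2 - r)) i ^ 2 =
      ∏ m ∈ Finset.range n, meanDeriv σ (K (m + 2)) i ^ 2 := fun i => by
    rw [← Finset.Ico_add_one_right_eq_Icc,
      Finset.prod_Ico_reflect (fun m => meanDeriv σ (K m) i ^ 2) 1 (by omega),
      Finset.prod_Ico_eq_prod_range, show n + 2 + 1 - (n + 1) = 2 by omega]
    simp [add_comm 2]
  have hfactorial : (d.factorial : ℝ) ≠ 0 := Nat.cast_ne_zero.2 d.factorial_ne_zero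
  simp only [detBound, diagBound, Nat.add_sub_cancel, hreindex]
  rw [sum_embedding_prod fun i => ∏ m ∈ Finset.range n, meanDeriv σ (K (m + 2)) i ^ 2,
    Fintype.card_fin, Finset.prod_mul_distrib, Finset.prod_const, Finset.card_univ,
    Fintype.card_fin, mul_pow, ← pow_mul, mul_comm d]
  field_simp

lemma detBound_pos (hCW : 0 < CW) (h2 : 0 < minEigen (K 2)) {n : ℕ}
    (hm : ∀ m < n, ∀ k, meanDeriv σ (K (m + 2)) k ≠ 0) :
    0 < detBound σ CW K (n + 2) := by
  rw [detBound_eq_prod_diagBound]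
  exact Finset.prod_pos fun i _ => mul_pos (by positivity) <|
    Finset.prod_pos fun m hmn => sq_pos_of_ne_zero (hm m (Finset.mem_range.1 hmn) i)

lemma detBound_le_det_hatCov [NeZero d] (hσ : LipschitzWith c σ) (hCb : 0 ≤ Cb) (hCW : 0 ≤ CW)
    (h2 : (K 2).PosSemidef) (hK : ∀ n, K (n + 3) = covStep σ Cb CW (K (n + 2))) (n : ℕ) :
    detBound σ CW K (n + 3) ≤ (hatCov Cb (K (n + 3))).det := by
  have hdiag : 0 ≤ Matrix.diagonal (diagBound σ CW K (n + 1)) :=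
    (Matrix.PosSemidef.diagonal (diagBound_nonneg hCW h2 (n + 1))).nonneg
  rw [detBound_eq_prod_diagBound, ← Matrix.det_diagonal]
  exact det_le_det_of_le hdiag (diagonal_diagBound_succ_le_hatCov hσ hCb hCW h2 hK
    (diagonal_diagBound_le hσ hCb hCW h2 hK n))

end Recursion

section FirstLayer

lemma firstLayer_eq_sum {Ω : Type*} {n₀ : ℕ} (CW : ℝ) (b : Ω → ℝ) (W : Fin n₀ → Ω → ℝ)
    (x : EuclideanSpace ℝ (Fin n₀)) (ω : Ω) :
    firstLayer CW b W x ω = ∑ o : Option (Fin n₀),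
      o.elim 1 (fun k => Real.sqrt CW / Real.sqrt n₀ * x k) * (o.elim b W : Ω → ℝ) ω := by
  simp only [firstLayer, Fintype.sum_option, Option.elim, one_mul, Finset.mul_sum]
  congr! 2 with k
  ring

variable {Ω : Type*} [MeasurableSpace Ω] {P : Measure Ω} {n₀ d : ℕ} {Cb : ℝ≥0} {CW : ℝ}
  {c : ℝ≥0} {σ : ℝ → ℝ} {b : Ω → ℝ} {W : Fin n₀ → Ω → ℝ}

/-- The bias `b` and the weights `W` of the first layer are square integrable and pairwise
orthogonal, with `E[b²] = C_b` and `E[Wₖ²] = 1`. They form one family indexed by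
`Option (Fin n₀)`, with the bias at `none`. -/
structure IsOrthogonalLayer (P : Measure Ω) (Cb : ℝ≥0) (b : Ω → ℝ) (W : Fin n₀ → Ω → ℝ) :
    Prop where
  memLp : ∀ o : Option (Fin n₀), MemLp (o.elim b W) 2 P
  secondMoment_eq : secondMoment P (fun o : Option (Fin n₀) => o.elim b W) =
    Matrix.diagonal fun o => o.elim (Cb : ℝ) 1

lemma memLp_two_of_integral_sq_ne_zero {X : Ω → ℝ} (hX : AEMeasurable X P)
    (h : ∫ ω, X ω ^ 2 ∂P ≠ 0) : MemLp X 2 P :=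
  (memLp_two_iff_integrable_sq hX.aestronglyMeasurable).2 (not_imp_comm.1 integral_undef h)

lemma integral_sq_of_hasLaw_gaussianReal_zero {X : Ω → ℝ} {v : ℝ≥0}
    (hX : HasLaw X (gaussianReal 0 v) P) : ∫ ω, X ω ^ 2 ∂P = v := by
  have hmean : ∫ ω, X ω ∂P = 0 := by rw [hX.integral_eq, integral_id_gaussianReal]
  rw [← variance_of_integral_eq_zero hX.aemeasurable hmean, hX.variance_eq,
    variance_id_gaussianReal]

lemma secondMoment_eq_diagonal_of_pairwise_indepFun {ι : Type*} [DecidableEq ι]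
    {X : ι → Ω → ℝ} (hX : ∀ i, AEStronglyMeasurable (X i) P)
    (hind : Pairwise fun i j => IndepFun (X i) (X j) P)
    (hmean : Pairwise fun i j => ∫ ω, X i ω ∂P = 0 ∨ ∫ ω, X j ω ∂P = 0) :
    secondMoment P X = Matrix.diagonal fun i => ∫ ω, X i ω ^ 2 ∂P := by
  ext i j
  rcases eq_or_ne i j with rfl | hij
  · simp [secondMoment, pow_two]
  · rw [secondMoment, Matrix.of_apply, Matrix.diagonal_apply_ne _ hij,
      (hind hij).integral_fun_mul_eq_mul_integral (hX i) (hX j)]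
    exact mul_eq_zero.2 (hmean hij)

namespace IsOrthogonalLayer

lemma of_iIndepFun (hb : HasLaw b (gaussianReal 0 Cb) P) (hW : ∀ k, AEMeasurable (W k) P)
    (hW1 : ∀ k, ∫ ω, W k ω ∂P = 0) (hW2 : ∀ k, ∫ ω, W k ω ^ 2 ∂P = 1)
    (hind : iIndepFun (fun o : Option (Fin n₀) => o.elim b W) P) :
    IsOrthogonalLayer P Cb b W := by
  have hL2 : ∀ o : Option (Fin n₀), MemLp (o.elim b W) 2 P
    | none => hb.hasGaussianLaw.memLp_two
    | some k => memLp_two_of_integral_sq_ne_zero (hW k) (by simp [hW2])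
  have hsq : ∀ o : Option (Fin n₀), ∫ ω, (o.elim b W : Ω → ℝ) ω ^ 2 ∂P = o.elim (Cb : ℝ) 1
    | none => integral_sq_of_hasLaw_gaussianReal_zero hb
    | some k => hW2 k
  refine ⟨hL2, ?_⟩
  rw [secondMoment_eq_diagonal_of_pairwise_indepFun (fun o => (hL2 o).1)
    fun _ _ hij => hind.indepFun hij]
  · simp only [hsq]
  · rintro (_ | k) (_ | k') hne
    exacts [absurd rfl hne, .inr (hW1 k'), .inl (hW1 k), .inl (hW1 k)]

lemma memLp_firstLayer (h : IsOrthogonalLayer P Cb b W) (x : EuclideanSpace ℝ (Fin n₀)) :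
    MemLp (firstLayer CW b W x) 2 P := by
  rw [funext (firstLayer_eq_sum CW b W x)]
  exact memLp_finsetSum _ fun o _ => (h.memLp o).const_mul _

lemma integral_firstLayer_sq (h : IsOrthogonalLayer P Cb b W) (hCW : 0 ≤ CW)
    (x : EuclideanSpace ℝ (Fin n₀)) :
    ∫ ω, firstLayer CW b W x ω ^ 2 ∂P = Cb + CW * (‖x‖ ^ 2 / n₀) := by
  simp only [firstLayer_eq_sum]
  rw [integral_sum_mul_sq h.memLp, h.secondMoment_eq]
  simp only [dotProduct, Matrix.mulVec_diagonal, Fintype.sum_option, Option.elim, one_mul, mul_one,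
    Pi.one_apply]
  rw [EuclideanSpace.real_norm_sq_eq, Finset.sum_div, Finset.mul_sum]
  congr! 2 with k
  calc Real.sqrt CW / Real.sqrt n₀ * x k * (Real.sqrt CW / Real.sqrt n₀ * x k)
      = Real.sqrt CW ^ 2 / Real.sqrt n₀ ^ 2 * x k ^ 2 := by ring
    _ = CW * (x k ^ 2 / n₀) := by
      rw [Real.sq_sqrt hCW, Real.sq_sqrt (Nat.cast_nonneg _)]
      ring

variable [IsProbabilityMeasure P]

lemma posSemidef_secondCov (h : IsOrthogonalLayer P Cb b W) (hCW : 0 ≤ CW)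
    (hσ : LipschitzWith c σ) (x : Fin d → EuclideanSpace ℝ (Fin n₀)) :
    (secondCov P σ Cb CW b W x).PosSemidef := by
  have hhat : hatCov Cb (secondCov P σ Cb CW b W x) =
      CW • secondMoment P fun j ω => σ (firstLayer CW b W (x j) ω) := by
    ext j k
    simp [hatCov, secondCov, secondMoment]
  refine posSemidef_of_posSemidef_hatCov Cb.coe_nonneg ?_
  rw [hhat]
  exact (posSemidef_secondMoment fun j =>
    memLp_comp_of_lipschitzWith hσ (h.memLp_firstLayer (x j))).smul hCW

lemma trace_secondCov_le (h : IsOrthogonalLayer P Cb b W) (hCW : 0 ≤ CW)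
    (hσ : LipschitzWith c σ) (x : Fin d → EuclideanSpace ℝ (Fin n₀)) :
    (secondCov P σ Cb CW b W x).trace ≤ d * (Cb + 2 * CW * σ 0 ^ 2) +
      2 * CW * c ^ 2 * (d * Cb + CW * ((∑ j, ‖x j‖ ^ 2) / n₀)) := by
  have hentry : ∀ j, secondCov P σ Cb CW b W x j j ≤
      Cb + CW * (2 * σ 0 ^ 2 + 2 * c ^ 2 * (Cb + CW * (‖x j‖ ^ 2 / n₀))) := fun j => by
    simp only [secondCov, Matrix.of_apply, ← pow_two]
    rw [← h.integral_firstLayer_sq hCW (x j)]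
    gcongr
    exact integral_sq_le_of_lipschitzWith hσ (h.memLp_firstLayer (x j))
  calc (secondCov P σ Cb CW b W x).trace
      ≤ ∑ j, (Cb + CW * (2 * σ 0 ^ 2 + 2 * c ^ 2 * (Cb + CW * (‖x j‖ ^ 2 / n₀)))) :=
        Finset.sum_le_sum fun j _ => hentry j
    _ = d * (Cb + 2 * CW * σ 0 ^ 2) +
        2 * CW * c ^ 2 * (d * Cb + CW * ((∑ j, ‖x j‖ ^ 2) / n₀)) := by
        simp only [Finset.sum_add_distrib, ← Finset.mul_sum, ← Finset.sum_div, Finset.sum_const,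
          Finset.card_univ, Fintype.card_fin, nsmul_eq_mul]
        ring

end IsOrthogonalLayer

end FirstLayer

section LimitCov

lemma mul_add_add_le_one_add_sq_mul {a s w d k X : ℝ} (ha : 0 ≤ a) (hs : 0 ≤ s) (hw : 0 ≤ w)
    (hd : 0 ≤ d) (hk : 0 ≤ k) (hX : 0 ≤ X) :
    k * (d * (a + 2 * w * s)) + (d * a + w * X) ≤
      (1 + w) ^ 2 * (d * (k + 1) * (a + 2 * s) + X) := by
  have hstep : a + 2 * w * s ≤ (1 + w) * (a + 2 * s) := by nlinarith [mul_nonneg hw ha]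
  have hbase : a ≤ (1 + w) * (a + 2 * s) := by nlinarith [mul_nonneg hw ha, mul_nonneg hw hs]
  calc k * (d * (a + 2 * w * s)) + (d * a + w * X)
      ≤ k * (d * ((1 + w) * (a + 2 * s))) + (d * ((1 + w) * (a + 2 * s)) + (1 + w) * X) := by
        gcongr
        linarith
    _ = (1 + w) * (d * (k + 1) * (a + 2 * s) + X) := by ring
    _ ≤ (1 + w) ^ 2 * (d * (k + 1) * (a + 2 * s) + X) := by
        gcongr
        nlinarith

variable {Ω : Type*} [MeasurableSpace Ω] {P : Measure Ω} [IsProbabilityMeasure P] {n₀ d : ℕ}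
  {Cb : ℝ≥0} {CW : ℝ} {c : ℝ≥0} {σ : ℝ → ℝ} {b : Ω → ℝ} {W : Fin n₀ → Ω → ℝ}

lemma IsOrthogonalLayer.trace_limitCov_le_traceBound (h : IsOrthogonalLayer P Cb b W)
    (hCW : 0 ≤ CW) (hσ : LipschitzWith c σ) (x : Fin d → EuclideanSpace ℝ (Fin n₀)) (n : ℕ) :
    (limitCov P σ Cb CW b W x (n + 2)).trace ≤ traceBound σ Cb CW x (n + 2) := by
  have hlip := lipschitzWith_lipNorm hσ
  have hX : 0 ≤ (∑ j, ‖x j‖ ^ 2) / (n₀ : ℝ) := by positivity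
  have hrec := trace_le_of_covStep (K := limitCov P σ Cb CW b W x) hlip Cb.coe_nonneg hCW
    (h.posSemidef_secondCov hCW hσ x) (fun _ => rfl) (by positivity)
    (h.trace_secondCov_le hCW hlip x) n
  have harith := mul_add_add_le_one_add_sq_mul Cb.coe_nonneg (sq_nonneg (σ 0)) hCW
    (Nat.cast_nonneg d) n.cast_add_one_pos.le hX
  calc (limitCov P σ Cb CW b W x (n + 2)).trace
      ≤ (1 + (2 * CW * (lipNorm σ : ℝ) ^ 2) ^ (n + 1)) *
          ((n + 1) * (d * (Cb + 2 * CW * σ 0 ^ 2)) +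
            (d * Cb + CW * ((∑ j, ‖x j‖ ^ 2) / n₀))) := hrec
    _ ≤ (1 + (2 * CW * (lipNorm σ : ℝ) ^ 2) ^ (n + 1)) *
          ((1 + CW) ^ 2 *
            (d * (n + 1 + 1) * (Cb + 2 * σ 0 ^ 2) + (∑ j, ‖x j‖ ^ 2) / n₀)) :=
        mul_le_mul_of_nonneg_left harith (by positivity)
    _ = traceBound σ Cb CW x (n + 2) := by
        rw [traceBound, sq_abs, show n + 2 - 1 = n + 1 by omega]
        push_cast
        ring

end LimitCov

theorem mainTheorem5_general
    {Ω : Type*} [MeasurableSpace Ω] (P : Measure Ω) [IsProbabilityMeasure P]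
    (n₀ d : ℕ) (hn₀ : 0 < n₀) (hd : 0 < d) (Cb : ℝ≥0) (CW : ℝ) (hCW : 0 < CW)
    (σ : ℝ → ℝ) {c : ℝ≥0} (hσ : LipschitzWith c σ)
    (b : Ω → ℝ) (W : Fin n₀ → Ω → ℝ) (hbW : IsOrthogonalLayer P Cb b W)
    (x : Fin d → EuclideanSpace ℝ (Fin n₀))
    (K : ℕ → Matrix (Fin d) (Fin d) ℝ) (hK : K = limitCov P σ Cb CW b W x)
    (ℓ : ℕ) (hℓ : 3 ≤ ℓ) :
    detBound σ CW K ℓ ≤ (hatCov Cb (K ℓ)).det ∧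
    detBound σ CW K ℓ ≤
      (CW * ∑ j, meanSq σ (K (ℓ - 1)) j) ^ (d - 1) * minEigen (K ℓ) ∧
    detBound σ CW K ℓ ≤ traceBound σ Cb CW x ℓ ^ (d - 1) * minEigen (K ℓ) ∧
    (0 < minEigen (K 2) →
      (∀ m ∈ Finset.Icc 2 (ℓ - 1), ∀ k, meanDeriv σ (K m) k ≠ 0) →
      0 < detBound σ CW K ℓ ∧
      0 < minEigen (hatCov Cb (K ℓ)) ∧
      minEigen (hatCov Cb (K ℓ)) ≤ minEigen (K ℓ) ∧
      (minEigen (K ℓ))⁻¹ ≤ (minEigen (hatCov Cb (K ℓ)))⁻¹ ∧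
      (minEigen (hatCov Cb (K ℓ)))⁻¹ ≤
        (hatCov Cb (K ℓ)).trace ^ (d - 1) / (hatCov Cb (K ℓ)).det ∧
      (hatCov Cb (K ℓ)).trace ^ (d - 1) / (hatCov Cb (K ℓ)).det ≤
        (CW * ∑ j, meanSq σ (K (ℓ - 1)) j) ^ (d - 1) / detBound σ CW K ℓ ∧
      (CW * ∑ j, meanSq σ (K (ℓ - 1)) j) ^ (d - 1) / detBound σ CW K ℓ ≤
        traceBound σ Cb CW x ℓ ^ (d - 1) / detBound σ CW K ℓ) := by
  have := NeZero.of_pos hd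
  obtain ⟨n, rfl⟩ := Nat.exists_eq_add_of_le' hℓ
  have h2 : (K 2).PosSemidef := hK ▸ hbW.posSemidef_secondCov hCW.le hσ x
  have hrec : ∀ n, K (n + 3) = covStep σ Cb CW (K (n + 2)) := fun n => by rw [hK]; rfl
  have hhat : (hatCov Cb (K (n + 3))).PosSemidef :=
    hrec n ▸ posSemidef_hatCov_covStep hσ hCW.le
  have hle := hatCov_le Cb.coe_nonneg (K (n + 3))
  have hdet := detBound_le_det_hatCov hσ Cb.coe_nonneg hCW.le h2 hrec n
  have htr : (hatCov Cb (K (n + 3))).trace = CW * ∑ j, meanSq σ (K (n + 2)) j :=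
    hrec n ▸ trace_hatCov_covStep σ Cb CW (K (n + 2))
  have htrT : (hatCov Cb (K (n + 3))).trace ≤ traceBound σ Cb CW x (n + 3) :=
    (trace_hatCov_le Cb.coe_nonneg _).trans
      (hK ▸ hbW.trace_limitCov_le_traceBound hCW.le hσ x (n + 1))
  refine ⟨hdet, ?_, hdet.trans (det_le_pow_mul_minEigen_of_le hhat hle htrT), fun hlam hm => ?_⟩
  · exact hdet.trans (det_le_pow_mul_minEigen_of_le hhat hle htr.le)
  have hD : 0 < detBound σ CW K (n + 3) := detBound_pos hCW hlam fun m hmn =>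
    hm (m + 2) (Finset.mem_Icc.2 ⟨by omega, by omega⟩)
  have hdetpos := hD.trans_le hdet
  have hlampos := minEigen_pos_of_det_pos hhat hdetpos
  have hmono := minEigen_mono hhat.isHermitian hle
  refine ⟨hD, hlampos, hmono, inv_anti₀ hlampos hmono,
    inv_minEigen_le_trace_pow_div_det hhat hdetpos, ?_, ?_⟩
  · rw [htr]
    exact div_le_div_of_nonneg_left (pow_nonneg (htr ▸ hhat.trace_nonneg) _) hD hdet
  · exact div_le_div_of_nonneg_right
      (pow_le_pow_left₀ (htr ▸ hhat.trace_nonneg) (htr ▸ htrT) _) hD.le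

theorem mainTheorem5
    {Ω : Type*} [MeasurableSpace Ω] (P : Measure Ω) [IsProbabilityMeasure P]
    (n₀ d : ℕ) (hn₀ : 0 < n₀) (hd : 0 < d)
    (Cb : ℝ≥0) (CW : ℝ) (hCW : 0 < CW)
    (σ : ℝ → ℝ) (hσ : ∃ c : ℝ≥0, LipschitzWith c σ)
    -- first-layer bias and weights
    (b : Ω → ℝ) (W : Fin n₀ → Ω → ℝ)
    (hb : HasLaw b (gaussianReal 0 Cb) P)
    (hW : ∀ k, AEMeasurable (W k) P)
    (hWid : ∀ k k', IdentDistrib (W k) (W k') P P)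
    (hW1 : ∀ k, ∫ ω, W k ω ∂P = 0)
    (hW2 : ∀ k, ∫ ω, W k ω ^ 2 ∂P = 1)
    (hind : iIndepFun (fun o : Option (Fin n₀) => o.elim b W) P)
    (x : Fin d → EuclideanSpace ℝ (Fin n₀))
    -- the limiting covariance matrices
    (K : ℕ → Matrix (Fin d) (Fin d) ℝ) (hK : K = limitCov P σ Cb CW b W x)
    (ℓ : ℕ) (hℓ : 3 ≤ ℓ) :
    -- lower bound on the determinant
    detBound σ CW K ℓ ≤ (hatCov Cb (K ℓ)).det ∧
    -- lower bounds on the smallest eigenvalue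
    detBound σ CW K ℓ ≤
      (CW * ∑ j, meanSq σ (K (ℓ - 1)) j) ^ (d - 1) * minEigen (K ℓ) ∧
    detBound σ CW K ℓ ≤ traceBound σ Cb CW x ℓ ^ (d - 1) * minEigen (K ℓ) ∧
    -- the same for the inverse of the smallest eigenvalue, in the nondegenerate case
    (0 < minEigen (K 2) →
      (∀ m ∈ Finset.Icc 2 (ℓ - 1), ∀ k, meanDeriv σ (K m) k ≠ 0) →
      0 < detBound σ CW K ℓ ∧
      0 < minEigen (hatCov Cb (K ℓ)) ∧
      minEigen (hatCov Cb (K ℓ)) ≤ minEigen (K ℓ) ∧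
      (minEigen (K ℓ))⁻¹ ≤ (minEigen (hatCov Cb (K ℓ)))⁻¹ ∧
      (minEigen (hatCov Cb (K ℓ)))⁻¹ ≤
        (hatCov Cb (K ℓ)).trace ^ (d - 1) / (hatCov Cb (K ℓ)).det ∧
      (hatCov Cb (K ℓ)).trace ^ (d - 1) / (hatCov Cb (K ℓ)).det ≤
        (CW * ∑ j, meanSq σ (K (ℓ - 1)) j) ^ (d - 1) / detBound σ CW K ℓ ∧
      (CW * ∑ j, meanSq σ (K (ℓ - 1)) j) ^ (d - 1) / detBound σ CW K ℓ ≤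
        traceBound σ Cb CW x ℓ ^ (d - 1) / detBound σ CW K ℓ) := by
  obtain ⟨c, hσ⟩ := hσ
  exact mainTheorem5_general P n₀ d hn₀ hd Cb CW hCW σ hσ b W (.of_iIndepFun hb hW hW1 hW2 hind)
    x K hK ℓ hℓ
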